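/- All graphs are finite, simple and undirected. For a graph $G$, an independent dominating set is a set $D\subseteq V(G)$ of pairwise non-adjacent vertices such that every vertex of $G$ lies in $D$ or has a neighbour in $D$; the independent domination number $\gamma_i(G)$ is the minimum cardinality of an independent dominating set of $G$. The independent bondage number $b_i(G)$ is the minimum cardinality of a set $B\subseteq E(G)$ of edges such that $\gamma_i(G-B)>\gamma_i(G)$ (with $b_i(G)=\infty$ if no such $B$ exists). Let $\delta(G)$ denote the minimum degree of $G$, and let $g(G)$ denote the girth of $G$, i.e. the length of a shortest cycle ($\infty$ if there is none). Theorem. Every (non-empty) planar graph $G$ with $\delta(G)\ge 2$ and $g(G)\ge 10$ satisfies $b_i(G)\le 3$. -/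

import Mathlib

namespace IndepBondage

/-! ### Planar graphs -/

/-- `S` is a simple polygonal arc from `a` to `b` in the plane: it is traced by a polyline
`p 0 = a, p 1, …, p n = b` with non-degenerate segments, in which consecutive segments share
only their common corner and all other pairs of segments are disjoint. -/
def IsPolygonalArc (a b : ℝ × ℝ) (S : Set (ℝ × ℝ)) : Prop :=
  ∃ (n : ℕ) (p : ℕ → ℝ × ℝ),
    p 0 = a ∧ p n = b ∧
    (∀ i < n, p i ≠ p (i + 1)) ∧
    (∀ i, i + 1 < n →
      segment ℝ (p i) (p (i + 1)) ∩ segment ℝ (p (i + 1)) (p (i + 2)) = {p (i + 1)}) ∧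
    (∀ i j, i + 1 < j → j < n →
      Disjoint (segment ℝ (p i) (p (i + 1))) (segment ℝ (p j) (p (j + 1)))) ∧
    S = ⋃ i ∈ Set.Iio n, segment ℝ (p i) (p (i + 1))

/-- A drawing of `G` in the plane without crossings: vertices are distinct points, each edge is
a simple polygonal arc joining its ends, an arc passes through no vertex other than its ends,
and two different arcs meet only in common ends. (Values of `arc` off the edge set of `G` are
irrelevant.) -/
structure PlaneDrawing {V : Type*} (G : SimpleGraph V) where
  point : V → ℝ × ℝ
  arc : Sym2 V → Set (ℝ × ℝ)
  point_injective : Function.Injective point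
  isPolygonalArc : ∀ u v, G.Adj u v → IsPolygonalArc (point u) (point v) (arc s(u, v))
  mem_of_point_mem : ∀ e ∈ G.edgeSet, ∀ v, point v ∈ arc e → v ∈ e
  inter_subset : ∀ e ∈ G.edgeSet, ∀ f ∈ G.edgeSet, e ≠ f →
    arc e ∩ arc f ⊆ point '' {v | v ∈ e ∧ v ∈ f}

/-- A graph is planar if it can be drawn in the plane without crossings. -/
def IsPlanar {V : Type*} (G : SimpleGraph V) : Prop :=
  Nonempty (PlaneDrawing G)

/-! ### Independent domination and independent bondage -/

/-- `D` is dominating: every vertex lies in `D` or has a neighbour in `D`. -/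
def IsDominating {V : Type*} (G : SimpleGraph V) (D : Finset V) : Prop :=
  ∀ v, v ∈ D ∨ ∃ u ∈ D, G.Adj u v

/-- `D` is both independent and dominating. -/
def IsIndepDominating {V : Type*} (G : SimpleGraph V) (D : Finset V) : Prop :=
  G.IsIndepSet (D : Set V) ∧ IsDominating G D

/-- Every finite graph has an independent dominating set (a maximal independent set), so the
infimum in `indepDominationNumber` is a minimum. -/
theorem exists_isIndepDominating {V : Type*} [Fintype V] (G : SimpleGraph V) :
    ∃ D : Finset V, IsIndepDominating G D := by
  classical
  obtain ⟨D, hD, hmax⟩ := Finset.exists_max_image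
    (Finset.univ.filter fun D : Finset V => G.IsIndepSet (D : Set V)) Finset.card
    ⟨∅, by simp [SimpleGraph.IsIndepSet]⟩
  rw [Finset.mem_filter] at hD
  refine ⟨D, hD.2, fun v => ?_⟩
  by_contra h
  push Not at h
  obtain ⟨hv, hadj⟩ := h
  have hins : G.IsIndepSet ((insert v D : Finset V) : Set V) := by
    rw [Finset.coe_insert]
    exact Set.Pairwise.insert hD.2 fun u hu _ => ⟨fun h => hadj u hu h.symm, hadj u hu⟩
  have := hmax (insert v D) (by simpa using hins)
  rw [Finset.card_insert_of_notMem hv] at this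
  omega

/-- The independent domination number: the least size of an independent dominating set. -/
noncomputable def indepDominationNumber {V : Type*} [Fintype V] (G : SimpleGraph V) : ℕ :=
  sInf {k | ∃ D : Finset V, IsIndepDominating G D ∧ D.card = k}

/-- The independent bondage number: the least size of a set of edges of `G` whose deletion
increases the independent domination number (`⊤` if there is no such set of edges). -/
noncomputable def indepBondageNumber {V : Type*} [Fintype V] (G : SimpleGraph V) : ℕ∞ :=
  ⨅ (B : Finset (Sym2 V)) (_ : (B : Set (Sym2 V)) ⊆ G.edgeSet ∧
    indepDominationNumber G < indepDominationNumber (G.deleteEdges (B : Set (Sym2 V)))),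
    (B.card : ℕ∞)

end IndepBondage

/-! Two configurations are reducible: two adjacent vertices of degree two, and a vertex of degree
three whose neighbours all have degree two. In each, three edges can be deleted so that every
independent dominating set of the remaining graph can be changed locally into a strictly smaller one
of `G` (`indepBondageNumber_le_three_of_adj`, `indepBondageNumber_le_three_of_claw`).

If neither occurs, discharging gives `10 |V| ≤ 8 |E|`. Planarity and girth at least 10 give `8 |E| +
10 ≤ 10 |V|` (`IsPlanar.mul_card_edgeSet_le`), a contradiction.

The second inequality rests on faces defined by parity, with no Jordan curve theorem. Fix a basis of
the cycle space over `ZMod 2` and attach to each point off the drawing the vector of parities of the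
numbers of edges of the basis elements above it. The points with a given vector form a union of
faces. Its boundary is again a cycle vector, each edge lies on at most two such boundaries, and they
span the cycle space (`IsPlanar.exists_faces`). The dimension exceeds `|E| - |V|`, and each nonzero
boundary has at least girth many edges, so counting edge-boundary incidences finishes the argument.
-/

namespace IndepBondage

/-! ### Reducible configurations -/

section Reducible

theorem isIndepDominating_iff {V : Type*} {G : SimpleGraph V} {D : Finset V} :
    IsIndepDominating G D ↔ (∀ x ∈ D, ∀ y ∈ D, ¬ G.Adj x y) ∧ ∀ v, v ∉ D → ∃ u ∈ D, G.Adj u v := by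
  constructor
  · rintro ⟨h1, h2⟩
    refine ⟨fun x hx y hy hxy => h1 hx hy hxy.ne hxy, fun v hv => (h2 v).resolve_left hv⟩
  · rintro ⟨h1, h2⟩
    exact ⟨fun x hx y hy _ => h1 x hx y hy, fun v => or_iff_not_imp_left.2 (h2 v)⟩

variable {V : Type*} [Fintype V]

theorem indepBondageNumber_le_three {G : SimpleGraph V} (B : Finset (Sym2 V))
    (hB : (B : Set (Sym2 V)) ⊆ G.edgeSet) (hcard : B.card ≤ 3)
    (h : ∀ D', IsIndepDominating (G.deleteEdges (B : Set (Sym2 V))) D' →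
      ∃ D, IsIndepDominating G D ∧ D.card < D'.card) :
    indepBondageNumber G ≤ 3 := by
  have hlt : indepDominationNumber G <
      indepDominationNumber (G.deleteEdges (B : Set (Sym2 V))) := by
    obtain ⟨D₀, hD₀⟩ := exists_isIndepDominating (G.deleteEdges (B : Set (Sym2 V)))
    obtain ⟨D', hD', hc⟩ := Nat.sInf_mem (s := {k | ∃ D : Finset V,
      IsIndepDominating (G.deleteEdges (B : Set (Sym2 V))) D ∧ D.card = k}) ⟨_, D₀, hD₀, rfl⟩
    obtain ⟨D, hD, hlt⟩ := h D' hD'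
    calc indepDominationNumber G ≤ D.card := Nat.sInf_le ⟨D, hD, rfl⟩
      _ < D'.card := hlt
      _ = _ := hc
  calc indepBondageNumber G ≤ (B.card : ℕ∞) := iInf₂_le B ⟨hB, hlt⟩
    _ ≤ 3 := by exact_mod_cast hcard

/-- Two adjacent vertices of degree two. -/
theorem indepBondageNumber_le_three_of_adj {G : SimpleGraph V} {u v a b : V}
    (hu : ∀ t, G.Adj u t ↔ t = v ∨ t = a) (hv : ∀ t, G.Adj v t ↔ t = u ∨ t = b) :
    indepBondageNumber G ≤ 3 := by
  classical
  have hua : G.Adj u a := (hu a).2 (Or.inr rfl)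
  have huv : G.Adj u v := (hu v).2 (Or.inl rfl)
  have hvb : G.Adj v b := (hv b).2 (Or.inr rfl)
  -- Deleting these edges isolates `u` and `v`, which forces both into `D'`.
  refine indepBondageNumber_le_three {s(u, a), s(u, v), s(v, b)} ?_ Finset.card_le_three ?_
  · intro e he
    simp only [Finset.coe_insert, Finset.coe_singleton, Set.mem_insert_iff,
      Set.mem_singleton_iff] at he
    rcases he with rfl | rfl | rfl <;> assumption
  intro D' hD'
  obtain ⟨hi, hd⟩ := isIndepDominating_iff.1 hD'
  have hsymm : ∀ x y, G.Adj x y → G.Adj y x := fun x y h => h.symm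
  have hne : ∀ x y, G.Adj x y → x ≠ y := fun x y h => h.ne
  have adj : ∀ x y, (G.deleteEdges
      (({s(u, a), s(u, v), s(v, b)} : Finset (Sym2 V)) : Set (Sym2 V))).Adj x y ↔
      G.Adj x y ∧ x ≠ u ∧ x ≠ v ∧ y ≠ u ∧ y ≠ v := by
    intro x y
    simp only [SimpleGraph.deleteEdges_adj, Finset.coe_insert, Finset.coe_singleton,
      Set.mem_insert_iff, Set.mem_singleton_iff, Sym2.eq_iff]
    grind
  simp only [adj] at hi hd
  clear adj hD'
  have hmu : u ∈ D' := by by_contra h; obtain ⟨t, -, ht⟩ := hd u h; grind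
  have hmv : v ∈ D' := by by_contra h; obtain ⟨t, -, ht⟩ := hd v h; grind
  have key : ∀ D : Finset V, (∀ t, t ≠ u → t ≠ v → (t ∈ D ↔ t ∈ D')) →
      ¬ (u ∈ D ∧ v ∈ D) → (u ∈ D → a ∉ D) → (v ∈ D → b ∉ D) → (u ∈ D ∨ v ∈ D ∨ a ∈ D) →
      (v ∈ D ∨ u ∈ D ∨ b ∈ D) → IsIndepDominating G D := by
    intro D h1 h2 h3 h4 h5 h6
    rw [isIndepDominating_iff]
    have hnu : u ∈ D → ∀ t ∈ D, ¬ G.Adj u t := by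
      intro h t ht hut
      rcases (hu t).1 hut with rfl | rfl
      exacts [h2 ⟨h, ht⟩, h3 h ht]
    have hnv : v ∈ D → ∀ t ∈ D, ¬ G.Adj v t := by
      intro h t ht hvt
      rcases (hv t).1 hvt with rfl | rfl
      exacts [h2 ⟨ht, h⟩, h4 h ht]
    refine ⟨?_, fun t ht => ?_⟩
    · intro s hs t ht hst
      by_cases hsu : s = u
      · exact hnu (hsu ▸ hs) t ht (hsu ▸ hst)
      by_cases hsv : s = v
      · exact hnv (hsv ▸ hs) t ht (hsv ▸ hst)
      by_cases htu : t = u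
      · exact hnu (htu ▸ ht) s hs (htu ▸ hst.symm)
      by_cases htv : t = v
      · exact hnv (htv ▸ ht) s hs (htv ▸ hst.symm)
      exact hi s ((h1 s hsu hsv).1 hs) t ((h1 t htu htv).1 ht) ⟨hst, hsu, hsv, htu, htv⟩
    by_cases htu : t = u
    · grind
    by_cases htv : t = v
    · grind
    obtain ⟨s, hs, hs'⟩ := hd t (by grind)
    exact ⟨s, by grind, hs'.1⟩
  have hcu : (D'.erase u).card < D'.card := Finset.card_erase_lt_of_mem hmu
  have hcv : (D'.erase v).card < D'.card := Finset.card_erase_lt_of_mem hmv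
  have hcuv : ((D'.erase u).erase v).card < D'.card := (Finset.card_erase_le).trans_lt hcu
  -- If both outer neighbours are in `D'`, then `u` and `v` are both dropped. Otherwise one whose
  -- outer neighbour is missing is kept and dominates the other. The clause `a ≠ v` matters because
  -- `hu` permits `a = v`.
  by_cases ha : a ∈ D' ∧ a ≠ v
  · by_cases hb : b ∈ D' ∧ b ≠ u
    · exact ⟨_, key ((D'.erase u).erase v) (by grind) (by grind) (by grind) (by grind)
        (by grind) (by grind), hcuv⟩
    · exact ⟨_, key (D'.erase u) (by grind) (by grind) (by grind) (by grind)
        (by grind) (by grind), hcu⟩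
  · exact ⟨_, key (D'.erase v) (by grind) (by grind) (by grind) (by grind)
        (by grind) (by grind), hcv⟩

/-- A vertex of degree three all of whose neighbours have degree two. -/
theorem indepBondageNumber_le_three_of_claw {G : SimpleGraph V} {w x y z x' y' z' : V}
    (hxy : x ≠ y) (hxz : x ≠ z) (hyz : y ≠ z)
    (hw : ∀ t, G.Adj w t ↔ t = x ∨ t = y ∨ t = z)
    (hx : ∀ t, G.Adj x t ↔ t = w ∨ t = x') (hy : ∀ t, G.Adj y t ↔ t = w ∨ t = y')
    (hz : ∀ t, G.Adj z t ↔ t = w ∨ t = z')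
    (hx'w : x' ≠ w) (hy'w : y' ≠ w) (hz'w : z' ≠ w)
    (hnxy : ¬ G.Adj x y) (hnxz : ¬ G.Adj x z) (hnyz : ¬ G.Adj y z) :
    indepBondageNumber G ≤ 3 := by
  classical
  have hxx : G.Adj x x' := (hx x').2 (Or.inr rfl)
  have hxw : G.Adj x w := (hx w).2 (Or.inl rfl)
  have hyy : G.Adj y y' := (hy y').2 (Or.inr rfl)
  -- The deletion isolates `x` and leaves `y` pendant at `w`. So `D'` contains `x`, and it contains
  -- `y` unless it contains `w`.
  refine indepBondageNumber_le_three {s(x, x'), s(x, w), s(y, y')} ?_ Finset.card_le_three ?_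
  · intro e he
    simp only [Finset.coe_insert, Finset.coe_singleton, Set.mem_insert_iff,
      Set.mem_singleton_iff] at he
    rcases he with rfl | rfl | rfl <;> assumption
  intro D' hD'
  obtain ⟨hi, hd⟩ := isIndepDominating_iff.1 hD'
  have hsymm : ∀ x y, G.Adj x y → G.Adj y x := fun x y h => h.symm
  have hne : ∀ x y, G.Adj x y → x ≠ y := fun x y h => h.ne
  have adj : ∀ s t, (G.deleteEdges
      (({s(x, x'), s(x, w), s(y, y')} : Finset (Sym2 V)) : Set (Sym2 V))).Adj s t ↔
      G.Adj s t ∧ s ≠ x ∧ t ≠ x ∧ (s = y → t = w) ∧ (t = y → s = w) := by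
    intro s t
    simp only [SimpleGraph.deleteEdges_adj, Finset.coe_insert, Finset.coe_singleton,
      Set.mem_insert_iff, Set.mem_singleton_iff, Sym2.eq_iff]
    grind
  simp only [adj] at hi hd
  clear adj hD'
  have hmx : x ∈ D' := by by_contra h; obtain ⟨t, -, ht⟩ := hd x h; grind
  have hcx : (D'.erase x).card < D'.card := Finset.card_erase_lt_of_mem hmx
  by_cases hmw : w ∈ D'
  · have hmy : y ∉ D' := by grind
    refine ⟨D'.erase x, isIndepDominating_iff.2 ⟨by grind, fun t ht => ?_⟩, hcx⟩
    by_cases htx : t = x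
    · exact ⟨w, by grind, by grind⟩
    obtain ⟨s, hs, hs'⟩ := hd t (by grind)
    exact ⟨s, by grind, hs'.1⟩
  have hmy : y ∈ D' := by by_contra h; obtain ⟨t, ht', ht⟩ := hd y h; grind
  -- `E` is smaller than `D'` by two, so one vertex may be added to it. Only `x`, `y` and `w` can be
  -- undominated by `E`.
  obtain ⟨E, hE⟩ : ∃ E, E = (D'.erase x).erase y := ⟨_, rfl⟩
  have hcE : E.card + 1 < D'.card := by
    have : y ∈ D'.erase x := by grind
    have := Finset.card_erase_lt_of_mem this
    rw [hE]; omega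
  have hEmem : ∀ t, t ∈ E ↔ t ∈ D' ∧ t ≠ x ∧ t ≠ y := by grind
  have hins : ∀ t, (insert t E).card < D'.card := fun t =>
    (Finset.card_insert_le t E).trans_lt hcE
  have hdE : ∀ t, t ∉ E → t ≠ x → t ≠ y → t ≠ w → ∃ s ∈ E, G.Adj s t := by
    intro t ht h1 h2 h3
    obtain ⟨s, hs, hs'⟩ := hd t (by grind)
    exact ⟨s, by grind, hs'.1⟩
  have hiE : ∀ s ∈ E, ∀ t ∈ E, ¬ G.Adj s t := by grind
  by_cases hzE : z ∈ E
  swap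
  · refine ⟨insert w E, isIndepDominating_iff.2 ⟨by grind, fun t ht => ?_⟩, hins w⟩
    by_cases htx : t = x
    · exact ⟨w, by grind, by grind⟩
    by_cases hty : t = y
    · exact ⟨w, by grind, by grind⟩
    obtain ⟨s, hs, hs'⟩ := hdE t (by grind) htx hty (by grind)
    exact ⟨s, by grind, hs'⟩
  by_cases hx'E : x' ∈ E
  · by_cases hy'E : y' ∈ E
    · refine ⟨E, isIndepDominating_iff.2 ⟨hiE, fun t ht => ?_⟩, by omega⟩
      by_cases htx : t = x
      · exact ⟨x', by grind, by grind⟩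
      by_cases hty : t = y
      · exact ⟨y', by grind, by grind⟩
      by_cases htw : t = w
      · exact ⟨z, by grind, by grind⟩
      exact hdE t (by grind) htx hty (by grind)
    · refine ⟨insert y E, isIndepDominating_iff.2 ⟨by grind, fun t ht => ?_⟩, hins y⟩
      by_cases htx : t = x
      · exact ⟨x', by grind, by grind⟩
      by_cases htw : t = w
      · exact ⟨z, by grind, by grind⟩
      obtain ⟨s, hs, hs'⟩ := hdE t (by grind) htx (by grind) (by grind)
      exact ⟨s, by grind, hs'⟩
  by_cases hy'E : y' ∈ E
  · refine ⟨insert x E, isIndepDominating_iff.2 ⟨by grind, fun t ht => ?_⟩, hins x⟩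
    by_cases hty : t = y
    · exact ⟨y', by grind, by grind⟩
    by_cases htw : t = w
    · exact ⟨z, by grind, by grind⟩
    obtain ⟨s, hs, hs'⟩ := hdE t (by grind) (by grind) (by grind) (by grind)
    exact ⟨s, by grind, hs'⟩
  have hz'E : z' ∉ E := by grind
  -- Exchanging `z` for `w` costs nothing. Now `w` dominates `x`, `y` and `z`, and only `z'` can
  -- have lost its dominator, so adding `z'` suffices if needed.
  obtain ⟨F, hF⟩ : ∃ F, F = insert w (E.erase z) := ⟨_, rfl⟩
  have hcF : F.card + 1 < D'.card := by
    have h1 := Finset.card_erase_lt_of_mem hzE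
    have h2 := Finset.card_insert_le w (E.erase z)
    rw [hF]; omega
  have hFmem : ∀ t, t ∈ F ↔ t = w ∨ t ∈ E ∧ t ≠ z := by grind
  have hiF : ∀ s ∈ F, ∀ t ∈ F, ¬ G.Adj s t := by grind
  have hdF : ∀ t, t ∉ F → t ≠ z' → ∃ s ∈ F, G.Adj s t := by
    intro t ht h1
    by_cases htw : G.Adj w t
    · exact ⟨w, by grind, htw⟩
    obtain ⟨s, hs, hs'⟩ := hdE t (by grind) (by grind) (by grind) (by grind)
    exact ⟨s, by grind, hs'⟩
  by_cases hz' : z' ∈ F ∨ ∃ s ∈ F, G.Adj s z'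
  · refine ⟨F, isIndepDominating_iff.2 ⟨hiF, fun t ht => ?_⟩, by omega⟩
    by_cases htz : t = z'
    · exact htz ▸ hz'.resolve_left (htz ▸ ht)
    · exact hdF t ht htz
  · refine ⟨insert z' F, isIndepDominating_iff.2 ⟨by grind, fun t ht => ?_⟩,
      (Finset.card_insert_le _ _).trans_lt hcF⟩
    obtain ⟨s, hs, hs'⟩ := hdF t (by grind) (by grind)
    exact ⟨s, by grind, hs'⟩

end Reducible

/-! ### Discharging -/

section Discharging

variable {V : Type*} [Fintype V]

/-- If no two vertices of degree two are adjacent and no vertex of degree three has only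
neighbours of degree two, then the average degree is at least `5 / 2`. -/
theorem ten_mul_card_le_eight_mul_card_edgeFinset (G : SimpleGraph V) [DecidableRel G.Adj]
    (hdeg : ∀ v, 2 ≤ G.degree v)
    (h22 : ∀ u v, G.Adj u v → G.degree u = 2 → G.degree v ≠ 2)
    (h3 : ∀ w, G.degree w = 3 → ∃ v, G.Adj w v ∧ G.degree v ≠ 2) :
    10 * Fintype.card V ≤ 8 * G.edgeFinset.card := by
  classical
  let c : V → ℕ := fun v => if G.degree v = 2 then 1 else 0
  -- Each vertex has charge `4 * degree - 10` and gives 1 to every neighbour of degree two. A vertex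
  -- of degree two starts at `-2`, receives 2 and gives nothing; degree three gives at most 2 out of
  -- 2; degree `d ≥ 4` can afford `d`.
  have hloc : ∀ w, (∑ v, if G.Adj w v then c v else 0) + 10 ≤ 4 * G.degree w + 2 * c w := by
    intro w
    have hsum : (∑ v, if G.Adj w v then c v else 0) =
        ((G.neighborFinset w).filter fun v => G.degree v = 2).card := by
      rw [Finset.card_filter, ← Finset.sum_filter]
      refine Finset.sum_congr ?_ fun _ _ => rfl
      ext v; simp
    have hle : ((G.neighborFinset w).filter fun v => G.degree v = 2).card ≤ G.degree w :=
      Finset.card_filter_le _ _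
    rw [hsum]
    rcases (hdeg w).eq_or_lt with h | h
    · have : ((G.neighborFinset w).filter fun v => G.degree v = 2) = ∅ := by
        rw [Finset.filter_eq_empty_iff]
        intro v hv
        exact h22 w v (by simpa using hv) h.symm
      rw [this]
      simp [c, ← h]
    · rcases (show 3 ≤ G.degree w from h).eq_or_lt with h' | h'
      · obtain ⟨v, hv, hv2⟩ := h3 w h'.symm
        have : ((G.neighborFinset w).filter fun v => G.degree v = 2).card < G.degree w := by
          refine Finset.card_lt_card (Finset.filter_ssubset.2 ⟨v, by simpa using hv, hv2⟩)
        omega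
      · omega
  have hdouble : ∑ w, ∑ v, (if G.Adj w v then c v else 0) = 2 * ∑ v, c v := by
    rw [Finset.sum_comm, Finset.mul_sum]
    refine Finset.sum_congr rfl fun v _ => ?_
    rw [← Finset.sum_filter, Finset.sum_const, smul_eq_mul]
    have : (Finset.univ.filter fun w => G.Adj w v).card = G.degree v := by
      rw [← G.card_neighborFinset_eq_degree]
      congr 1
      ext t; simp [G.adj_comm]
    rw [this]
    by_cases h : G.degree v = 2 <;> simp [c, h]
  have hall := Finset.sum_le_sum fun w (_ : w ∈ Finset.univ) => hloc w
  rw [Finset.sum_add_distrib, Finset.sum_add_distrib, hdouble, ← Finset.mul_sum,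
    ← Finset.mul_sum, G.sum_degrees_eq_twice_card_edges] at hall
  simp only [Finset.sum_const, Finset.card_univ, smul_eq_mul] at hall
  omega

end Discharging

/-! ### Vertical order of non-crossing segments -/

section Segments

/-- A set of edges, given by its indicator function, in which every point is the end of an even
number of edges; the edge `p` has the ends `a p` and `b p`. -/
def IsEven {P X : Type*} [Fintype P] [DecidableEq X] (a b : P → X) (C : P → ZMod 2) : Prop :=
  ∀ v, ∑ p, ((if a p = v then C p else 0) + (if b p = v then C p else 0)) = 0

/-- A system of non-vertical segments in the plane that meet only in common ends, such that
different ends have different first coordinates. -/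
structure SegmentSystem (P : Type*) where
  left : P → ℝ × ℝ
  right : P → ℝ × ℝ
  lt : ∀ p, (left p).1 < (right p).1
  left_eq_left : ∀ p q, (left p).1 = (left q).1 → left p = left q
  right_eq_right : ∀ p q, (right p).1 = (right q).1 → right p = right q
  inter : ∀ p q, p ≠ q → ∀ x ∈ segment ℝ (left p) (right p), x ∈ segment ℝ (left q) (right q) →
    (x = left p ∨ x = right p) ∧ (x = left q ∨ x = right q)

namespace SegmentSystem

variable {P : Type*} (S : SegmentSystem P)

noncomputable def slope (p : P) : ℝ :=
  ((S.right p).2 - (S.left p).2) / ((S.right p).1 - (S.left p).1)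

noncomputable def height (p : P) (x : ℝ) : ℝ := (S.left p).2 + (x - (S.left p).1) * S.slope p

def Spans (p : P) (x : ℝ) : Prop := (S.left p).1 ≤ x ∧ x ≤ (S.right p).1

theorem height_left (p : P) : S.height p (S.left p).1 = (S.left p).2 := by simp [height]

theorem height_right (p : P) : S.height p (S.right p).1 = (S.right p).2 := by
  have := S.lt p
  have h : (S.right p).1 - (S.left p).1 ≠ 0 := by linarith
  simp only [height, slope]
  field_simp
  ring

theorem height_sub (p : P) (x x' : ℝ) : S.height p x = S.height p x' + (x - x') * S.slope p := by
  simp only [height]; ring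

theorem mem_segment {p : P} {x : ℝ} (hx : S.Spans p x) :
    (x, S.height p x) ∈ segment ℝ (S.left p) (S.right p) := by
  have hlt := S.lt p
  have hpos : 0 < (S.right p).1 - (S.left p).1 := by linarith
  rw [segment_eq_image']
  refine ⟨(x - (S.left p).1) / ((S.right p).1 - (S.left p).1),
    ⟨div_nonneg (by linarith [hx.1]) hpos.le, (div_le_one hpos).2 (by linarith [hx.2])⟩, ?_⟩
  ext
  · simp [div_mul_cancel₀ _ hpos.ne']
  · simp only [height, slope, Prod.snd_add, Prod.smul_snd, Prod.snd_sub, smul_eq_mul]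
    ring

theorem eq_of_height_eq {p q : P} (hpq : p ≠ q) {x : ℝ} (hp : S.Spans p x) (hq : S.Spans q x)
    (h : S.height p x = S.height q x) :
    (x = (S.left p).1 ∨ x = (S.right p).1) ∧ (x = (S.left q).1 ∨ x = (S.right q).1) := by
  obtain ⟨h1, h2⟩ := S.inter p q hpq _ (S.mem_segment hp) (h ▸ S.mem_segment hq)
  exact ⟨h1.imp (congrArg Prod.fst) (congrArg Prod.fst),
    h2.imp (congrArg Prod.fst) (congrArg Prod.fst)⟩

/-- The segment `q` lies above `p` somewhere. -/
def Above (q p : P) : Prop := ∃ x, S.Spans p x ∧ S.Spans q x ∧ S.height p x < S.height q x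

variable {S}

/-- The height difference is affine. A change of sign would make the segments meet strictly inside
their common range, away from all ends. -/
theorem Above.height_le {p q : P} (h : S.Above q p) {x : ℝ} (hp : S.Spans p x)
    (hq : S.Spans q x) : S.height p x ≤ S.height q x := by
  obtain ⟨x₀, hp₀, hq₀, h₀⟩ := h
  by_contra! hlt
  have hpq : p ≠ q := by rintro rfl; exact h₀.ne rfl
  set a := S.height q x₀ - S.height p x₀ with ha
  set b := S.height p x - S.height q x with hb
  have ha0 : 0 < a := by linarith
  have hb0 : 0 < b := by linarith
  have hab : 0 < a + b := by linarith
  set t := (b * x₀ + a * x) / (a + b) with ht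
  have hx : x ≠ x₀ := by rintro rfl; linarith
  have ht1 : t - x = b * (x₀ - x) / (a + b) := by rw [ht]; field_simp; ring
  have ht2 : t - x₀ = a * (x - x₀) / (a + b) := by rw [ht]; field_simp; ring
  have hbetween : (x < t ∧ t < x₀) ∨ (x₀ < t ∧ t < x) := by
    rcases lt_or_gt_of_ne hx with h | h
    · left
      have h1 : 0 < b * (x₀ - x) / (a + b) := div_pos (mul_pos hb0 (by linarith)) hab
      have h2 : a * (x - x₀) / (a + b) < 0 :=
        div_neg_of_neg_of_pos (mul_neg_of_pos_of_neg ha0 (by linarith)) hab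
      constructor <;> linarith
    · right
      have h1 : b * (x₀ - x) / (a + b) < 0 :=
        div_neg_of_neg_of_pos (mul_neg_of_pos_of_neg hb0 (by linarith)) hab
      have h2 : 0 < a * (x - x₀) / (a + b) := div_pos (mul_pos ha0 (by linarith)) hab
      constructor <;> linarith
  have hzero : S.height p t = S.height q t := by
    have e1 : a + b = (x₀ - x) * (S.slope q - S.slope p) := by
      rw [ha, hb, S.height_sub q x₀ x, S.height_sub p x₀ x]; ring
    have e2 : (t - x) * (S.slope q - S.slope p) = b := by
      rw [ht1, div_mul_eq_mul_div, div_eq_iff hab.ne', mul_assoc, ← e1]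
    rw [S.height_sub p t x, S.height_sub q t x]
    linarith
  obtain ⟨h1, h2⟩ := S.eq_of_height_eq hpq (x := t)
    ⟨by rcases hbetween with h | h <;> linarith [hp.1, hp₀.1],
      by rcases hbetween with h | h <;> linarith [hp.2, hp₀.2]⟩
    ⟨by rcases hbetween with h | h <;> linarith [hq.1, hq₀.1],
      by rcases hbetween with h | h <;> linarith [hq.2, hq₀.2]⟩ hzero
  rcases h1 with h1 | h1 <;> rcases hbetween with h | h <;>
    linarith [hp.1, hp₀.1, hp.2, hp₀.2]

theorem above_iff_height_lt {p q : P} (hpq : p ≠ q) {x : ℝ} (hp : S.Spans p x) (hq : S.Spans q x)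
    (hx : (x ≠ (S.left p).1 ∧ x ≠ (S.right p).1) ∨ (x ≠ (S.left q).1 ∧ x ≠ (S.right q).1)) :
    S.Above q p ↔ S.height p x < S.height q x := by
  refine ⟨fun h => (h.height_le hp hq).lt_of_ne fun he => ?_, fun h => ⟨x, hp, hq, h⟩⟩
  obtain ⟨h1, h2⟩ := S.eq_of_height_eq hpq hp hq he
  tauto

theorem above_iff_of_left_eq {p q : P} (h : S.left q = S.left p) :
    S.Above q p ↔ S.slope p < S.slope q := by
  have e : ∀ x, S.height q x - S.height p x =
      (x - (S.left p).1) * (S.slope q - S.slope p) := by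
    intro x; simp only [height, h]; ring
  constructor
  · rintro ⟨x, hp, hq, hx⟩
    have := e x
    by_contra! hle
    nlinarith [hp.1]
  · intro hs
    refine ⟨min (S.right p).1 (S.right q).1, ⟨le_min (S.lt p).le ?_, min_le_left _ _⟩,
      ⟨le_min ?_ (S.lt q).le, min_le_right _ _⟩, ?_⟩
    · rw [← h]; exact (S.lt q).le
    · rw [h]; exact (S.lt p).le
    · have h1 : (S.left p).1 < min (S.right p).1 (S.right q).1 :=
        lt_min (S.lt p) (by rw [← h]; exact S.lt q)
      have := e (min (S.right p).1 (S.right q).1)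
      nlinarith

theorem above_iff_of_right_eq {p q : P} (h : S.right q = S.right p) :
    S.Above q p ↔ S.slope q < S.slope p := by
  have e : ∀ x, S.height q x - S.height p x =
      ((S.right p).1 - x) * (S.slope p - S.slope q) := by
    intro x
    have h1 := S.height_sub q x (S.right q).1
    have h2 := S.height_sub p x (S.right p).1
    rw [S.height_right, h] at h1
    rw [S.height_right] at h2
    rw [h1, h2]; ring
  constructor
  · rintro ⟨x, hp, hq, hx⟩
    have := e x
    by_contra! hle
    nlinarith [hp.2]
  · intro hs
    refine ⟨max (S.left p).1 (S.left q).1, ⟨le_max_left _ _, max_le (S.lt p).le ?_⟩,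
      ⟨le_max_right _ _, max_le ?_ (S.lt q).le⟩, ?_⟩
    · rw [← h]; exact (S.lt q).le
    · rw [h]; exact (S.lt p).le
    · have h1 : max (S.left p).1 (S.left q).1 < (S.right p).1 :=
        max_lt (S.lt p) (by rw [← h]; exact S.lt q)
      have := e (max (S.left p).1 (S.left q).1)
      nlinarith

theorem eq_of_left_eq_of_slope_eq {p q : P} (h : S.left q = S.left p) (hs : S.slope q = S.slope p) :
    q = p := by
  by_contra hne
  have hp : S.Spans p (min (S.right p).1 (S.right q).1) :=
    ⟨le_min (S.lt p).le (by rw [← h]; exact (S.lt q).le), min_le_left _ _⟩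
  have hq : S.Spans q (min (S.right p).1 (S.right q).1) :=
    ⟨le_min (by rw [h]; exact (S.lt p).le) (S.lt q).le, min_le_right _ _⟩
  have hm : (S.left p).1 < min (S.right p).1 (S.right q).1 :=
    lt_min (S.lt p) (by rw [← h]; exact S.lt q)
  obtain ⟨m, hm1, hm2⟩ := exists_between hm
  have := (S.eq_of_height_eq hne (x := m) ⟨by rw [h]; exact hm1.le, hm2.le.trans hq.2⟩
    ⟨hm1.le, hm2.le.trans hp.2⟩ (by simp only [height, h, hs])).2
  rcases this with h' | h'
  · exact hm1.ne' h'
  · exact (hm2.trans_le hp.2).ne h'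

theorem eq_of_right_eq_of_slope_eq {p q : P} (h : S.right q = S.right p)
    (hs : S.slope q = S.slope p) : q = p := by
  by_contra hne
  have hm : max (S.left p).1 (S.left q).1 < (S.right p).1 :=
    max_lt (S.lt p) (by rw [← h]; exact S.lt q)
  obtain ⟨m, hm1, hm2⟩ := exists_between hm
  have e1 := S.height_sub q m (S.right q).1
  have e2 := S.height_sub p m (S.right p).1
  rw [S.height_right] at e1 e2
  have := (S.eq_of_height_eq hne (x := m)
    ⟨(le_max_right _ _).trans hm1.le, by rw [h]; exact hm2.le⟩
    ⟨(le_max_left _ _).trans hm1.le, hm2.le⟩ (by rw [e1, e2, h, hs])).2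
  rcases this with h' | h'
  · exact ((le_max_left _ _).trans_lt hm1).ne' h'
  · exact hm2.ne h'

variable (S)

/-- The segment `q` passes strictly above the point `v`. -/
def PassesAbove (q : P) (v : ℝ × ℝ) : Prop :=
  (S.left q).1 < v.1 ∧ v.1 < (S.right q).1 ∧ v.2 < S.height q v.1

/-- The half-open range of `q` keeps segments that start at the left end of `p` and drops those that
end there. Thus looking up from just right of this end sees what passes over it together with the
steeper part of its fan. -/
theorem above_left_iff (p q : P) :
    (S.Above q p ∧ (S.left q).1 ≤ (S.left p).1 ∧ (S.left p).1 < (S.right q).1) ↔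
      (S.PassesAbove q (S.left p) ∨ (S.left q = S.left p ∧ S.slope p < S.slope q)) := by
  rcases lt_trichotomy (S.left q).1 (S.left p).1 with h | h | h
  · have hne : S.left q ≠ S.left p := fun e => h.ne (congrArg Prod.fst e)
    have hpq : p ≠ q := by rintro rfl; exact hne rfl
    by_cases h2 : (S.left p).1 < (S.right q).1
    · have := S.above_iff_height_lt hpq (x := (S.left p).1) ⟨le_rfl, (S.lt p).le⟩ ⟨h.le, h2.le⟩
        (Or.inr ⟨h.ne', h2.ne⟩)
      rw [S.height_left] at this
      simp [PassesAbove, h, h.le, h2, hne, this]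
    · simp [PassesAbove, h2, hne]
  · have e := S.left_eq_left q p h
    rw [S.above_iff_of_left_eq e]
    simp [PassesAbove, e, h ▸ S.lt q]
  · have hne : S.left q ≠ S.left p := fun e => h.ne' (congrArg Prod.fst e)
    simp [PassesAbove, h.not_ge, h.not_gt, hne]

theorem above_right_iff (p q : P) :
    (S.Above q p ∧ (S.left q).1 < (S.right p).1 ∧ (S.right p).1 ≤ (S.right q).1) ↔
      (S.PassesAbove q (S.right p) ∨ (S.right q = S.right p ∧ S.slope q < S.slope p)) := by
  rcases lt_trichotomy (S.right p).1 (S.right q).1 with h | h | h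
  · have hne : S.right q ≠ S.right p := fun e => h.ne' (congrArg Prod.fst e)
    have hpq : p ≠ q := by rintro rfl; exact hne rfl
    by_cases h2 : (S.left q).1 < (S.right p).1
    · have := S.above_iff_height_lt hpq (x := (S.right p).1) ⟨(S.lt p).le, le_rfl⟩ ⟨h2.le, h.le⟩
        (Or.inr ⟨h2.ne', h.ne⟩)
      rw [S.height_right] at this
      simp [PassesAbove, h, h.le, h2, hne, this]
    · simp [PassesAbove, h2, hne]
  · have e := S.right_eq_right q p h.symm
    rw [S.above_iff_of_right_eq e]
    simp [PassesAbove, e, h ▸ S.lt q]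
  · have hne : S.right q ≠ S.right p := fun e => h.ne (congrArg Prod.fst e)
    simp [PassesAbove, h.not_ge, h.not_gt, hne]

/-- The region strictly above the interior of the segment `p`. -/
def region (p : P) : Set (ℝ × ℝ) :=
  {u | (S.left p).1 < u.1 ∧ u.1 < (S.right p).1 ∧ S.height p u.1 < u.2}

theorem left_mem_region_iff (p q : P) :
    S.left q ∈ S.region p ↔
      S.Above q p ∧ (S.left p).1 < (S.left q).1 ∧ (S.left q).1 < (S.right p).1 := by
  by_cases h : (S.left p).1 < (S.left q).1 ∧ (S.left q).1 < (S.right p).1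
  · have hpq : p ≠ q := by rintro rfl; exact h.1.ne rfl
    have := S.above_iff_height_lt hpq (x := (S.left q).1) ⟨h.1.le, h.2.le⟩ ⟨le_rfl, (S.lt q).le⟩
      (Or.inl ⟨h.1.ne', h.2.ne⟩)
    rw [S.height_left] at this
    simp [region, h, this]
  · simp only [region, Set.mem_ofPred_eq]; tauto

theorem right_mem_region_iff (p q : P) :
    S.right q ∈ S.region p ↔
      S.Above q p ∧ (S.left p).1 < (S.right q).1 ∧ (S.right q).1 < (S.right p).1 := by
  by_cases h : (S.left p).1 < (S.right q).1 ∧ (S.right q).1 < (S.right p).1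
  · have hpq : p ≠ q := by rintro rfl; exact h.2.ne rfl
    have := S.above_iff_height_lt hpq (x := (S.right q).1) ⟨h.1.le, h.2.le⟩ ⟨(S.lt q).le, le_rfl⟩
      (Or.inl ⟨h.1.ne', h.2.ne⟩)
    rw [S.height_right] at this
    simp [region, h, this]
  · simp only [region, Set.mem_ofPred_eq]; tauto

end SegmentSystem

/-- Turning around a vertex, the lower side of each segment is the upper side of the next one, so
the sum telescopes modulo 2 to the two extreme sectors. -/
theorem sum_fan {P X : Type*} [AddCommGroup X] (c : P → X) (U : X) (h : X → ZMod 2)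
    (s : P → ℝ) (R : Finset P) (hs : Set.InjOn s R) :
    ∑ p ∈ R, (h (U + ∑ q ∈ R with s p < s q, c q) + h (U + ∑ q ∈ R with s p ≤ s q, c q)) =
      h U + h (U + ∑ q ∈ R, c q) := by
  classical
  induction R using Finset.induction_on_min_value s with
  | empty => simp [CharTwo.add_self_eq_zero]
  | insert a R ha hmin ih =>
    have hlt : ∀ x ∈ R, s a < s x := fun x hx => (hmin x hx).lt_of_ne fun e =>
      ha (hs (by simp) (by simp [hx]) e ▸ hx)
    rw [Finset.sum_insert ha]
    have e1 : (insert a R).filter (fun q => s a < s q) = R := by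
      ext q; simp only [Finset.mem_filter, Finset.mem_insert]
      constructor
      · rintro ⟨rfl | h, h'⟩
        · exact absurd h' (lt_irrefl _)
        · exact h
      · exact fun h => ⟨Or.inr h, hlt q h⟩
    have e2 : (insert a R).filter (fun q => s a ≤ s q) = insert a R := by
      rw [Finset.filter_eq_self]
      intro q hq
      rcases Finset.mem_insert.1 hq with rfl | h
      exacts [le_rfl, hmin q h]
    have e3 : ∀ p ∈ R, (insert a R).filter (fun q => s p < s q) =
        R.filter (fun q => s p < s q) := fun p hp => by
      rw [Finset.filter_insert, if_neg (hlt p hp).not_gt]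
    have e4 : ∀ p ∈ R, (insert a R).filter (fun q => s p ≤ s q) =
        R.filter (fun q => s p ≤ s q) := fun p hp => by
      rw [Finset.filter_insert, if_neg (hlt p hp).not_ge]
    have e5 : ∑ p ∈ R, (h (U + ∑ q ∈ insert a R with s p < s q, c q) +
        h (U + ∑ q ∈ insert a R with s p ≤ s q, c q)) = h U + h (U + ∑ q ∈ R, c q) := by
      rw [← ih (hs.mono (by simp))]
      exact Finset.sum_congr rfl fun p hp => by rw [e3 p hp, e4 p hp]
    rw [e1, e2, e5]
    have := CharTwo.add_self_eq_zero (h (U + ∑ q ∈ R, c q))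
    linear_combination this

end Segments

/-! ### Faces as classes of parity vectors -/

section Faces

open scoped Classical

namespace SegmentSystem

variable {P : Type*} [Fintype P] (S : SegmentSystem P)

/-- The parity of the number of edges of `C` just above the segment `p`. -/
noncomputable def up (C : P → ZMod 2) (p : P) : ZMod 2 :=
  ∑ q, if S.Above q p ∧ (S.left q).1 ≤ (S.left p).1 ∧ (S.left p).1 < (S.right q).1 then C q else 0

/-- The parity of the number of edges of `C` that pass strictly above the point `v`. -/
noncomputable def upAt (C : P → ZMod 2) (v : ℝ × ℝ) : ZMod 2 :=
  ∑ q, if S.PassesAbove q v then C q else 0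

variable {S}

theorem up_eq_left (C : P → ZMod 2) (p : P) :
    S.up C p = S.upAt C (S.left p) +
      ∑ q with S.left q = S.left p ∧ S.slope p < S.slope q, C q := by
  rw [up, upAt, Finset.sum_filter, ← Finset.sum_add_distrib]
  refine Finset.sum_congr rfl fun q _ => ?_
  have hdis : S.PassesAbove q (S.left p) → ¬ (S.left q = S.left p ∧ S.slope p < S.slope q) :=
    fun h h' => h.1.ne (congrArg Prod.fst h'.1)
  simp only [S.above_left_iff]
  by_cases h1 : S.PassesAbove q (S.left p)
  · simp only [h1, hdis h1, true_or, if_true, if_false, add_zero]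
  · simp only [h1, false_or, if_false, zero_add]

theorem sum_above_right (C : P → ZMod 2) (p : P) :
    (∑ q, if S.Above q p ∧ (S.left q).1 < (S.right p).1 ∧ (S.right p).1 ≤ (S.right q).1
      then C q else 0) = S.upAt C (S.right p) +
      ∑ q with S.right q = S.right p ∧ S.slope q < S.slope p, C q := by
  rw [upAt, Finset.sum_filter, ← Finset.sum_add_distrib]
  refine Finset.sum_congr rfl fun q _ => ?_
  have hdis : S.PassesAbove q (S.right p) → ¬ (S.right q = S.right p ∧ S.slope q < S.slope p) :=
    fun h h' => h.2.1.ne' (congrArg Prod.fst h'.1)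
  simp only [S.above_right_iff]
  by_cases h1 : S.PassesAbove q (S.right p)
  · simp only [h1, hdis h1, true_or, if_true, if_false, add_zero]
  · simp only [h1, false_or, if_false, zero_add]

-- A segment above `p` either ends inside the open strip over `p` or continues past one of its
-- walls. If it enters the strip, it has exactly two such ends or exits in total; otherwise it has
-- none.
omit [Fintype P] in
theorem indicator_add_indicator (c : ZMod 2) (p q : P) :
    (if S.Above q p ∧ (S.left q).1 ≤ (S.left p).1 ∧ (S.left p).1 < (S.right q).1 then c else 0) +
      (if S.Above q p ∧ (S.left q).1 < (S.right p).1 ∧ (S.right p).1 ≤ (S.right q).1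
        then c else 0) =
      (if S.left q ∈ S.region p then c else 0) + (if S.right q ∈ S.region p then c else 0) := by
  have hc : c + c = 0 := CharTwo.add_self_eq_zero c
  have hp := S.lt p
  have hq := S.lt q
  simp only [S.left_mem_region_iff, S.right_mem_region_iff]
  by_cases h : S.Above q p
  · simp only [h, true_and]
    obtain ⟨x, h1, h2, -⟩ := h
    have h3 := h1.1.trans h2.2
    have h4 := h2.1.trans h1.2
    clear h1 h2
    generalize (S.left p).1 = a at *
    generalize (S.right p).1 = b at *
    generalize (S.left q).1 = a' at *
    generalize (S.right q).1 = b' at *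
    split_ifs <;> first | (simp only [hc, add_zero, zero_add]; done) | (exfalso; grind)
  · simp [h]

theorem sum_of_isEven {C : P → ZMod 2} (hC : IsEven S.left S.right C) (X : Set (ℝ × ℝ)) :
    ∑ q, ((if S.left q ∈ X then C q else 0) + (if S.right q ∈ X then C q else 0)) = 0 := by
  -- Only finitely many points of `X` are ends, so the evenness conditions at these points can be
  -- summed.
  let T : Finset (ℝ × ℝ) :=
    (Finset.univ.image S.left ∪ Finset.univ.image S.right).filter (· ∈ X)
  have hl : ∀ q, S.left q ∈ T ↔ S.left q ∈ X := by
    intro q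
    simp only [T, Finset.mem_filter, Finset.mem_union, Finset.mem_image, Finset.mem_univ, true_and]
    exact ⟨fun h => h.2, fun h => ⟨Or.inl ⟨q, rfl⟩, h⟩⟩
  have hr : ∀ q, S.right q ∈ T ↔ S.right q ∈ X := by
    intro q
    simp only [T, Finset.mem_filter, Finset.mem_union, Finset.mem_image, Finset.mem_univ, true_and]
    exact ⟨fun h => h.2, fun h => ⟨Or.inr ⟨q, rfl⟩, h⟩⟩
  calc _ = ∑ q, ∑ v ∈ T, ((if S.left q = v then C q else 0) +
        (if S.right q = v then C q else 0)) := by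
        refine Finset.sum_congr rfl fun q _ => ?_
        rw [Finset.sum_add_distrib, Finset.sum_ite_eq, Finset.sum_ite_eq]
        simp only [hl, hr]
    _ = 0 := by
        rw [Finset.sum_comm]
        exact Finset.sum_eq_zero fun v _ => hC v

/-- The parity above `p` is the same at both ends: by evenness, the segment ends lying in the region
above `p` contribute zero in total. -/
theorem up_eq_right {C : P → ZMod 2} (hC : IsEven S.left S.right C) (p : P) :
    S.up C p = S.upAt C (S.right p) +
      ∑ q with S.right q = S.right p ∧ S.slope q < S.slope p, C q := by
  have h := sum_of_isEven hC (S.region p)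
  simp only [← indicator_add_indicator] at h
  rw [Finset.sum_add_distrib, sum_above_right] at h
  exact CharTwo.add_eq_zero.1 h

section Family

variable {ι : Type*} {C : ι → P → ZMod 2}

variable (S C) in
/-- The vector of parities on the upper side of `p`. -/
noncomputable def upVec (p : P) : ι → ZMod 2 := fun i => S.up (C i) p

variable (S C) in
/-- The vector of parities on the lower side of `p`. -/
noncomputable def downVec (p : P) : ι → ZMod 2 := fun i => S.up (C i) p + C i p

theorem sum_left (h : (ι → ZMod 2) → ZMod 2) (v : ℝ × ℝ) :
    ∑ p with S.left p = v, (h (S.upVec C p) + h (S.downVec C p)) =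
      h (fun i => S.upAt (C i) v) +
        h (fun i => S.upAt (C i) v + ∑ q with S.left q = v, C i q) := by
  have hinj : Set.InjOn S.slope (Finset.univ.filter fun p => S.left p = v : Finset P) := by
    intro p hp q hq hs
    simp only [Finset.coe_filter, Finset.mem_univ, true_and, Set.mem_ofPred_eq] at hp hq
    exact eq_of_left_eq_of_slope_eq (hp.trans hq.symm) hs
  have := sum_fan (fun q i => C i q) (fun i => S.upAt (C i) v) h S.slope _ hinj
  have e : ((fun i => S.upAt (C i) v) + ∑ q with S.left q = v, fun i => C i q) =
      fun i => S.upAt (C i) v + ∑ q with S.left q = v, C i q := by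
    ext i; simp
  rw [e] at this
  rw [← this]
  refine Finset.sum_congr rfl fun p hp => ?_
  have hp' : S.left p = v := by simpa using hp
  have e1 : S.upVec C p = (fun i => S.upAt (C i) v) +
      ∑ q ∈ Finset.univ.filter (fun q => S.left q = v) with S.slope p < S.slope q,
        fun i => C i q := by
    ext i
    simp [upVec, up_eq_left, hp', Finset.filter_filter]
  have e2 : S.downVec C p = (fun i => S.upAt (C i) v) +
      ∑ q ∈ Finset.univ.filter (fun q => S.left q = v) with S.slope p ≤ S.slope q,
        fun i => C i q := by
    have e3 : (Finset.univ.filter (fun q => S.left q = v)).filter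
        (fun q => S.slope p ≤ S.slope q) =
        insert p ((Finset.univ.filter (fun q => S.left q = v)).filter
          (fun q => S.slope p < S.slope q)) := by
      ext q
      simp only [Finset.mem_filter, Finset.mem_univ, true_and, Finset.mem_insert]
      constructor
      · rintro ⟨h1, h2⟩
        rcases h2.eq_or_lt with h3 | h3
        · exact Or.inl (eq_of_left_eq_of_slope_eq (h1.trans hp'.symm) h3.symm)
        · exact Or.inr ⟨h1, h3⟩
      · rintro (rfl | ⟨h1, h2⟩)
        exacts [⟨hp', le_rfl⟩, ⟨h1, h2.le⟩]
    rw [e3, Finset.sum_insert (by simp)]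
    have : S.downVec C p = S.upVec C p + fun i => C i p := rfl
    rw [this, e1]
    abel
  rw [e1, e2]

theorem sum_right (hC : ∀ i, IsEven S.left S.right (C i)) (h : (ι → ZMod 2) → ZMod 2)
    (v : ℝ × ℝ) :
    ∑ p with S.right p = v, (h (S.upVec C p) + h (S.downVec C p)) =
      h (fun i => S.upAt (C i) v) +
        h (fun i => S.upAt (C i) v + ∑ q with S.right q = v, C i q) := by
  have hinj : Set.InjOn (fun p => - S.slope p)
      (Finset.univ.filter fun p => S.right p = v : Finset P) := by
    intro p hp q hq hs
    simp only [Finset.coe_filter, Finset.mem_univ, true_and, Set.mem_ofPred_eq] at hp hq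
    exact eq_of_right_eq_of_slope_eq (hp.trans hq.symm) (neg_inj.1 hs)
  have := sum_fan (fun q i => C i q) (fun i => S.upAt (C i) v) h (fun p => - S.slope p) _ hinj
  have e : ((fun i => S.upAt (C i) v) + ∑ q with S.right q = v, fun i => C i q) =
      fun i => S.upAt (C i) v + ∑ q with S.right q = v, C i q := by
    ext i; simp
  rw [e] at this
  rw [← this]
  refine Finset.sum_congr rfl fun p hp => ?_
  have hp' : S.right p = v := by simpa using hp
  have e1 : S.upVec C p = (fun i => S.upAt (C i) v) +
      ∑ q ∈ Finset.univ.filter (fun q => S.right q = v) with - S.slope p < - S.slope q,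
        fun i => C i q := by
    ext i
    simp [upVec, up_eq_right (hC i), hp', Finset.filter_filter]
  have e2 : S.downVec C p = (fun i => S.upAt (C i) v) +
      ∑ q ∈ Finset.univ.filter (fun q => S.right q = v) with - S.slope p ≤ - S.slope q,
        fun i => C i q := by
    have e3 : (Finset.univ.filter (fun q => S.right q = v)).filter
        (fun q => - S.slope p ≤ - S.slope q) =
        insert p ((Finset.univ.filter (fun q => S.right q = v)).filter
          (fun q => - S.slope p < - S.slope q)) := by
      ext q
      simp only [Finset.mem_filter, Finset.mem_univ, true_and, Finset.mem_insert]
      constructor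
      · rintro ⟨h1, h2⟩
        rcases h2.eq_or_lt with h3 | h3
        · exact Or.inl (eq_of_right_eq_of_slope_eq (h1.trans hp'.symm) (neg_inj.1 h3.symm))
        · exact Or.inr ⟨h1, h3⟩
      · rintro (rfl | ⟨h1, h2⟩)
        exacts [⟨hp', le_rfl⟩, ⟨h1, h2.le⟩]
    rw [e3, Finset.sum_insert (by simp)]
    have : S.downVec C p = S.upVec C p + fun i => C i p := rfl
    rw [this, e1]
    abel
  rw [e1, e2]

/-- The boundary of a union of faces is even. -/
theorem isEven_boundary (hC : ∀ i, IsEven S.left S.right (C i)) (h : (ι → ZMod 2) → ZMod 2) :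
    IsEven S.left S.right fun p => h (S.upVec C p) + h (S.downVec C p) := by
  intro v
  rw [Finset.sum_add_distrib, ← Finset.sum_filter, ← Finset.sum_filter, sum_left, sum_right hC]
  -- The fans to the right and to the left of `v` share the sector above `v`. They also share the
  -- one below, since each `C i` is even at `v`, so the two telescoped sums cancel.
  have e : (fun i => S.upAt (C i) v + ∑ q with S.left q = v, C i q) =
      fun i => S.upAt (C i) v + ∑ q with S.right q = v, C i q := by
    ext i
    have := hC i v
    rw [Finset.sum_add_distrib, ← Finset.sum_filter, ← Finset.sum_filter] at this
    rw [CharTwo.add_eq_zero.1 this]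
  rw [e]
  exact CharTwo.add_self_eq_zero _

end Family

end SegmentSystem

/-- A family of even edge sets of a segment system is spanned by even edge sets, the face
boundaries, of which each segment belongs to at most two. -/
theorem SegmentSystem.exists_faces {P ι : Type*} [Fintype P] [Fintype ι] [DecidableEq ι]
    (S : SegmentSystem P)
    (C : ι → P → ZMod 2) (hC : ∀ i, IsEven S.left S.right (C i)) :
    ∃ z : (ι → ZMod 2) → P → ZMod 2, (∀ κ, IsEven S.left S.right (z κ)) ∧
      (∀ p, (Finset.univ.filter fun κ => z κ p ≠ 0).card ≤ 2) ∧
      ∀ i p, C i p = ∑ κ, κ i * z κ p := by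
  -- A segment bounds the class `κ` when exactly one of its sides has parity vector `κ`. The two
  -- sides differ by `C i p` in coordinate `i`, which gives the spanning identity.
  refine ⟨fun κ p => (if S.upVec C p = κ then 1 else 0) + (if S.downVec C p = κ then 1 else 0),
    fun κ => isEven_boundary hC fun x => if x = κ then 1 else 0, fun p => ?_, fun i p => ?_⟩
  · refine (Finset.card_le_card (t := {S.upVec C p, S.downVec C p}) fun κ hκ => ?_).trans
      Finset.card_le_two
    by_contra hne
    simp only [Finset.mem_insert, Finset.mem_singleton, not_or] at hne
    simp [Ne.symm hne.1, Ne.symm hne.2] at hκ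
  · simp only [mul_add, Finset.sum_add_distrib, mul_ite, mul_one, mul_zero, Finset.sum_ite_eq,
      Finset.mem_univ, if_true, upVec, downVec]
    rw [← add_assoc, CharTwo.add_self_eq_zero, zero_add]

end Faces

/-! ### From plane drawings to segment systems -/

section Drawing

open scoped Classical

/-- Each pair of points with different second coordinates excludes one value of `t`, hence only
finitely many are excluded. -/
theorem exists_shear (T : Finset (ℝ × ℝ)) :
    ∃ t : ℝ, ∀ u ∈ T, ∀ v ∈ T, u.1 + t * u.2 = v.1 + t * v.2 → u = v := by
  obtain ⟨t, ht⟩ := Infinite.exists_notMem_finset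
    ((T ×ˢ T).image fun w => (w.2.1 - w.1.1) / (w.1.2 - w.2.2))
  refine ⟨t, fun u hu v hv h => ?_⟩
  by_cases h2 : u.2 = v.2
  · rw [h2] at h
    exact Prod.ext (add_right_cancel h) h2
  · refine absurd (Finset.mem_image.2 ⟨(u, v), Finset.mk_mem_product hu hv, ?_⟩) ht
    rw [div_eq_iff (sub_ne_zero.2 h2)]
    linarith

/-- The linear map `(x, y) ↦ (x + t y, y)`. -/
noncomputable def shear (t : ℝ) : (ℝ × ℝ) →ₗ[ℝ] (ℝ × ℝ) :=
  (LinearMap.fst ℝ ℝ ℝ + t • LinearMap.snd ℝ ℝ ℝ).prod (LinearMap.snd ℝ ℝ ℝ)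

theorem shear_apply (t : ℝ) (v : ℝ × ℝ) : shear t v = (v.1 + t * v.2, v.2) := by
  simp [shear]

theorem shear_injective (t : ℝ) : Function.Injective (shear t) := by
  intro u v h
  simp only [shear_apply, Prod.mk.injEq] at h
  obtain ⟨h1, h2⟩ := h
  rw [h2] at h1
  exact Prod.ext (add_right_cancel h1) h2

theorem shear_surjective (t : ℝ) : Function.Surjective (shear t) := fun v =>
  ⟨(v.1 - t * v.2, v.2), by simp [shear_apply]⟩

theorem exists_segmentSystem {P : Type*} [Fintype P] (a b : P → ℝ × ℝ) (hab : ∀ p, a p ≠ b p)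
    (hint : ∀ p q, p ≠ q → ∀ x ∈ segment ℝ (a p) (b p), x ∈ segment ℝ (a q) (b q) →
      (x = a p ∨ x = b p) ∧ (x = a q ∨ x = b q)) :
    ∃ S : SegmentSystem P, ∀ C, IsEven S.left S.right C ↔ IsEven a b C := by
  obtain ⟨t, ht⟩ := exists_shear (Finset.univ.image a ∪ Finset.univ.image b)
  have hT : ∀ p, a p ∈ Finset.univ.image a ∪ Finset.univ.image b ∧
      b p ∈ Finset.univ.image a ∪ Finset.univ.image b := fun p =>
    ⟨Finset.mem_union_left _ (by simp), Finset.mem_union_right _ (by simp)⟩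
  set T := Finset.univ.image a ∪ Finset.univ.image b
  set L := shear t with hL
  let l : P → ℝ × ℝ := fun p => if (L (a p)).1 < (L (b p)).1 then L (a p) else L (b p)
  let r : P → ℝ × ℝ := fun p => if (L (a p)).1 < (L (b p)).1 then L (b p) else L (a p)
  have hlr : ∀ p, (l p = L (a p) ∧ r p = L (b p)) ∨ (l p = L (b p) ∧ r p = L (a p)) := by
    intro p
    by_cases h : (L (a p)).1 < (L (b p)).1 <;> simp [l, r, h]
  have hLT : ∀ u ∈ T, ∀ v ∈ T, (L u).1 = (L v).1 → u = v := by
    intro u hu v hv h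
    simp only [hL, shear_apply] at h
    exact ht u hu v hv h
  have hl : ∀ p, ∃ u ∈ T, l p = L u := fun p => (hlr p).elim
    (fun h => ⟨a p, (hT p).1, h.1⟩) fun h => ⟨b p, (hT p).2, h.1⟩
  have hr : ∀ p, ∃ u ∈ T, r p = L u := fun p => (hlr p).elim
    (fun h => ⟨b p, (hT p).2, h.2⟩) fun h => ⟨a p, (hT p).1, h.2⟩
  have hseg : ∀ p, segment ℝ (l p) (r p) = L '' segment ℝ (a p) (b p) := by
    intro p
    have := image_segment ℝ L.toAffineMap (a p) (b p)
    simp only [LinearMap.coe_toAffineMap] at this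
    rw [this]
    rcases hlr p with ⟨h1, h2⟩ | ⟨h1, h2⟩
    · rw [h1, h2]
    · rw [h1, h2, segment_symm]
  refine ⟨⟨l, r, fun p => ?_, fun p q h => ?_, fun p q h => ?_, fun p q hpq x hx hx' => ?_⟩,
    fun C => ?_⟩
  · by_cases h : (L (a p)).1 < (L (b p)).1
    · simp only [l, r, h, if_true]
    · simp only [l, r, h, if_false]
      exact lt_of_le_of_ne (not_lt.1 h)
        fun e => hab p (hLT _ (hT p).1 _ (hT p).2 e.symm)
  · obtain ⟨u, hu, e⟩ := hl p
    obtain ⟨v, hv, e'⟩ := hl q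
    rw [e, e'] at h ⊢
    rw [hLT u hu v hv h]
  · obtain ⟨u, hu, e⟩ := hr p
    obtain ⟨v, hv, e'⟩ := hr q
    rw [e, e'] at h ⊢
    rw [hLT u hu v hv h]
  · rw [hseg] at hx hx'
    obtain ⟨y, hy, rfl⟩ := hx
    obtain ⟨y', hy', e⟩ := hx'
    obtain rfl := shear_injective t e
    obtain ⟨h1, h2⟩ := hint p q hpq _ hy hy'
    constructor
    · rcases hlr p with ⟨e1, e2⟩ | ⟨e1, e2⟩ <;> rw [e1, e2] <;>
        rcases h1 with h1 | h1 <;> rw [h1] <;> simp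
    · rcases hlr q with ⟨e1, e2⟩ | ⟨e1, e2⟩ <;> rw [e1, e2] <;>
        rcases h2 with h2 | h2 <;> rw [h2] <;> simp
  · refine (shear_surjective t).forall.trans (forall_congr' fun v => ?_)
    rw [Finset.sum_congr rfl]
    intro p _
    have e1 : (L (a p) = L v) = (a p = v) := propext (shear_injective t).eq_iff
    have e2 : (L (b p) = L v) = (b p = v) := propext (shear_injective t).eq_iff
    rcases hlr p with ⟨h1, h2⟩ | ⟨h1, h2⟩
    · simp only [h1, h2, ← hL, e1, e2]
    · simp only [h1, h2, ← hL, e1, e2]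
      rw [add_comm]

section Polyline

variable {n : ℕ} {p : ℕ → ℝ × ℝ}

/-- The corners of a polyline form a simple polygonal arc. -/
structure IsSimplePolyline (n : ℕ) (p : ℕ → ℝ × ℝ) : Prop where
  ne : ∀ i < n, p i ≠ p (i + 1)
  inter : ∀ i, i + 1 < n →
    segment ℝ (p i) (p (i + 1)) ∩ segment ℝ (p (i + 1)) (p (i + 2)) = {p (i + 1)}
  disjoint : ∀ i j, i + 1 < j → j < n →
    Disjoint (segment ℝ (p i) (p (i + 1))) (segment ℝ (p j) (p (j + 1)))

namespace IsSimplePolyline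

theorem eq_of_mem (h : IsSimplePolyline n p) {i j : ℕ} (hij : i < j) (hj : j < n) {x : ℝ × ℝ}
    (hi : x ∈ segment ℝ (p i) (p (i + 1))) (hx : x ∈ segment ℝ (p j) (p (j + 1))) :
    j = i + 1 ∧ x = p (i + 1) := by
  rcases (show i + 1 ≤ j from hij).eq_or_lt with rfl | h'
  · exact ⟨rfl, (h.inter i hj).subset ⟨hi, hx⟩⟩
  · exact absurd hx (Set.disjoint_left.1 (h.disjoint i j h' hj) hi)

theorem ne_of_lt (h : IsSimplePolyline n p) {i j : ℕ} (hij : i < j) (hj : j ≤ n) : p i ≠ p j := by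
  obtain ⟨j, rfl⟩ : ∃ k, j = k + 1 := ⟨j - 1, by omega⟩
  intro e
  rcases (show i ≤ j by omega).eq_or_lt with rfl | h'
  · exact h.ne i (by omega) e
  · obtain ⟨rfl, e'⟩ := h.eq_of_mem h' (by omega) (left_mem_segment ℝ _ _)
      (e ▸ right_mem_segment ℝ _ _)
    exact h.ne i (by omega) e'

theorem injOn (h : IsSimplePolyline n p) {i j : ℕ} (hi : i ≤ n) (hj : j ≤ n) (e : p i = p j) :
    i = j := by
  rcases lt_trichotomy i j with h' | h' | h'
  exacts [absurd e (h.ne_of_lt h' hj), h', absurd e.symm (h.ne_of_lt h' hi)]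

theorem eq_zero_of_mem (h : IsSimplePolyline n p) {i : ℕ} (hi : i < n)
    (hx : p 0 ∈ segment ℝ (p i) (p (i + 1))) : p 0 = p i := by
  rcases Nat.eq_zero_or_pos i with rfl | h'
  · rfl
  · obtain ⟨rfl, e⟩ := h.eq_of_mem h' hi (left_mem_segment ℝ _ _) hx
    exact e

theorem eq_last_of_mem (h : IsSimplePolyline n p) {i : ℕ} (hi : i < n)
    (hx : p n ∈ segment ℝ (p i) (p (i + 1))) : p n = p (i + 1) := by
  obtain ⟨m, rfl⟩ : ∃ m, n = m + 1 := ⟨n - 1, by omega⟩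
  rcases (show i ≤ m by omega).eq_or_lt with rfl | h'
  · rfl
  · exact (h.eq_of_mem h' (by omega) hx (right_mem_segment ℝ _ _)).2

end IsSimplePolyline

theorem sum_polyline {X : Type*} [DecidableEq X] (p : ℕ → X) (v : X) (c : ZMod 2) (n : ℕ) :
    ∑ i : Fin n, ((if p i = v then c else 0) + (if p (i + 1) = v then c else 0)) =
      (if p 0 = v then c else 0) + (if p n = v then c else 0) := by
  rw [Fin.sum_univ_eq_sum_range (fun i => (if p i = v then c else 0) +
    (if p (i + 1) = v then c else 0))]
  induction n with
  | zero => simp [CharTwo.add_self_eq_zero]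
  | succ n ih =>
    rw [Finset.sum_range_succ, ih]
    have := CharTwo.add_self_eq_zero (if p n = v then c else 0)
    linear_combination this

end Polyline

/-- A set of edges of `G`, given by its indicator function, that has even degree everywhere. -/
def IsCycleVector {V : Type*} (G : SimpleGraph V) [Fintype G.edgeSet] (c : G.edgeSet → ZMod 2) :
    Prop :=
  ∀ w, ∑ e : G.edgeSet, (if w ∈ e.1 then c e else 0) = 0

/-- A planar graph has a family of cycle vectors, the face boundaries, that span all cycle
vectors and such that each edge belongs to at most two of them. -/
theorem IsPlanar.exists_faces {V ι : Type*} {G : SimpleGraph V} [Fintype G.edgeSet] [Fintype ι]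
    [DecidableEq ι] (hG : IsPlanar G) (c : ι → G.edgeSet → ZMod 2) (hc : ∀ i, IsCycleVector G (c i)) :
    ∃ z : (ι → ZMod 2) → G.edgeSet → ZMod 2, (∀ κ, IsCycleVector G (z κ)) ∧
      (∀ e, (Finset.univ.filter fun κ => z κ e ≠ 0).card ≤ 2) ∧
      ∀ i e, c i e = ∑ κ, κ i * z κ e := by
  obtain ⟨D⟩ := hG
  have hpoly : ∀ e : G.edgeSet, ∃ (u v : V) (n : ℕ) (p : ℕ → ℝ × ℝ), e.1 = s(u, v) ∧ u ≠ v ∧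
      0 < n ∧ p 0 = D.point u ∧ p n = D.point v ∧ IsSimplePolyline n p ∧
      ∀ i < n, segment ℝ (p i) (p (i + 1)) ⊆ D.arc e.1 := by
    rintro ⟨e, he⟩
    induction e using Sym2.ind with
    | _ u v =>
      have hadj : G.Adj u v := he
      obtain ⟨n, p, h0, hn, h1, h2, h3, h4⟩ := D.isPolygonalArc u v hadj
      refine ⟨u, v, n, p, rfl, hadj.ne, Nat.pos_of_ne_zero ?_, h0, hn, ⟨h1, h2, h3⟩, ?_⟩
      · rintro rfl
        exact hadj.ne (D.point_injective (h0.symm.trans hn))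
      · intro i hi
        rw [h4]
        exact Set.subset_biUnion_of_mem (u := fun i => segment ℝ (p i) (p (i + 1)))
          (show i ∈ Set.Iio n from hi)
  choose u v n p he huv hn hp0 hpn hp harc using hpoly
  let a : (Σ e : G.edgeSet, Fin (n e)) → ℝ × ℝ := fun q => p q.1 q.2
  let b : (Σ e : G.edgeSet, Fin (n e)) → ℝ × ℝ := fun q => p q.1 (q.2 + 1)
  -- A segment of one arc meets another arc only at an end of its own whole arc, never at an inner
  -- corner.
  have hcross : ∀ e f : G.edgeSet, e ≠ f → ∀ i < n e, ∀ x ∈ segment ℝ (p e i) (p e (i + 1)),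
      x ∈ D.arc f.1 → (x = p e i ∧ x = p e 0) ∨ (x = p e (i + 1) ∧ x = p e (n e)) := by
    intro e f hef i hi x hx hxf
    obtain ⟨w, ⟨hwe, -⟩, rfl⟩ := D.inter_subset e.1 e.2 f.1 f.2 (fun h => hef (Subtype.ext h))
      ⟨harc e i hi hx, hxf⟩
    rw [he e, Sym2.mem_iff] at hwe
    rcases hwe with rfl | rfl
    · rw [← hp0 e] at hx ⊢
      exact Or.inl ⟨(hp e).eq_zero_of_mem hi hx, rfl⟩
    · rw [← hpn e] at hx ⊢
      exact Or.inr ⟨(hp e).eq_last_of_mem hi hx, rfl⟩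
  obtain ⟨S, hS⟩ := exists_segmentSystem a b (fun q => (hp q.1).ne q.2 q.2.2) (by
    rintro ⟨e, i⟩ ⟨f, j⟩ hne x hx hx'
    by_cases hef : e = f
    · subst hef
      have hij : i.1 ≠ j.1 := fun h => hne (by rw [Fin.ext h])
      rcases lt_or_gt_of_ne hij with h | h
      · obtain ⟨h1, h2⟩ := (hp e).eq_of_mem h j.2 hx hx'
        exact ⟨Or.inr h2, Or.inl (by simp only [a, h1]; exact h2)⟩
      · obtain ⟨h1, h2⟩ := (hp e).eq_of_mem h i.2 hx' hx
        exact ⟨Or.inl (by simp only [a, h1]; exact h2), Or.inr h2⟩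
    · exact ⟨(hcross e f hef i i.2 x hx (harc f j j.2 hx')).imp And.left And.left,
        (hcross f e (Ne.symm hef) j j.2 x hx' (harc e i i.2 hx)).imp And.left And.left⟩)
  have hends : ∀ (e : G.edgeSet) (w : V) (t : ZMod 2),
      (if u e = w then t else 0) + (if v e = w then t else 0) = if w ∈ e.1 then t else 0 := by
    intro e w t
    rw [he e]
    simp only [Sym2.mem_iff, eq_comm (a := w)]
    by_cases h1 : u e = w
    · have h2 : v e ≠ w := fun h => huv e (h1.trans h.symm)
      simp [h1, h2]
    · simp [h1]
  have hsum : ∀ (c : G.edgeSet → ZMod 2) (x : ℝ × ℝ),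
      ∑ q : (Σ e : G.edgeSet, Fin (n e)),
        ((if a q = x then c q.1 else 0) + (if b q = x then c q.1 else 0)) =
      ∑ e, ((if D.point (u e) = x then c e else 0) + (if D.point (v e) = x then c e else 0)) := by
    intro c x
    rw [Fintype.sum_sigma]
    refine Finset.sum_congr rfl fun e _ => ?_
    rw [← hp0, ← hpn]
    exact sum_polyline (p e) x (c e) (n e)
  have hlift : ∀ c : G.edgeSet → ZMod 2, IsEven a b (fun q => c q.1) ↔ IsCycleVector G c := by
    intro c
    simp only [IsEven, hsum]
    constructor
    · intro h w
      have := h (D.point w)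
      simpa only [D.point_injective.eq_iff, hends] using this
    · intro h x
      by_cases hx : ∃ w, x = D.point w
      · obtain ⟨w, rfl⟩ := hx
        simpa only [D.point_injective.eq_iff, hends] using h w
      · push Not at hx
        refine Finset.sum_eq_zero fun e _ => ?_
        rw [if_neg fun h => hx _ h.symm, if_neg fun h => hx _ h.symm, add_zero]
  -- Exactly two segments meet at an inner corner of an arc, so an even vector is constant along the
  -- arc and descends to the edges of `G`.
  have hconst : ∀ z, IsEven a b z → ∀ (e : G.edgeSet) (i : Fin (n e)),
      z ⟨e, i⟩ = z ⟨e, ⟨0, hn e⟩⟩ := by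
    intro z hz e
    have key : ∀ i (hi : i + 1 < n e), z ⟨e, ⟨i + 1, hi⟩⟩ = z ⟨e, ⟨i, by omega⟩⟩ := by
      intro i hi
      have hx := hz (p e (i + 1))
      have hother : ∀ f : G.edgeSet, f ≠ e → ∀ j < n f,
          p e (i + 1) ∉ segment ℝ (p f j) (p f (j + 1)) := by
        intro f hf j hj hmem
        rcases hcross e f (Ne.symm hf) i (by omega) _ (right_mem_segment ℝ _ _)
          (harc f j hj hmem) with ⟨-, h⟩ | ⟨-, h⟩
        · exact absurd ((hp e).injOn (by omega) (by omega) h) (by omega)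
        · exact absurd ((hp e).injOn (by omega) (by omega) h) (by omega)
      have ha : ∀ q, a q = p e (i + 1) ↔ q = ⟨e, ⟨i + 1, hi⟩⟩ := by
        rintro ⟨f, j⟩
        constructor
        · intro h
          by_cases hf : f = e
          · subst hf
            have : j = ⟨i + 1, hi⟩ := Fin.ext ((hp f).injOn j.2.le hi.le h)
            rw [this]
          · exact absurd (h ▸ left_mem_segment ℝ _ _) (hother f hf j j.2)
        · rintro h; rw [h]
      have hb : ∀ q, b q = p e (i + 1) ↔ q = ⟨e, ⟨i, by omega⟩⟩ := by
        rintro ⟨f, j⟩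
        constructor
        · intro h
          by_cases hf : f = e
          · subst hf
            have := (hp f).injOn (show j.1 + 1 ≤ n f from j.2) hi.le h
            have : j = ⟨i, by omega⟩ := Fin.ext (by simpa using this)
            rw [this]
          · exact absurd (h ▸ right_mem_segment ℝ _ _) (hother f hf j j.2)
        · rintro h; rw [h]
      simp only [ha, hb, Finset.sum_add_distrib, Finset.sum_ite_eq', Finset.mem_univ,
        if_true] at hx
      exact CharTwo.add_eq_zero.1 hx
    rintro ⟨i, hi⟩
    induction i with
    | zero => rfl
    | succ i ih => rw [key i hi, ih]
  obtain ⟨z, hz1, hz2, hz3⟩ := S.exists_faces (fun i q => c i q.1)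
    fun i => (hS _).2 ((hlift (c i)).2 (hc i))
  refine ⟨fun κ e => z κ ⟨e, ⟨0, hn e⟩⟩, fun κ => ?_, fun e => hz2 _, fun i e => hz3 i ⟨e, _⟩⟩
  have hev := (hS _).1 (hz1 κ)
  rw [← hlift]
  convert hev using 2 with q
  exact (hconst _ hev q.1 q.2).symm

end Drawing

/-! ### Cycle space and Euler's inequality -/

section Euler

open scoped Classical

variable {V : Type*} {G : SimpleGraph V}

/-- In an acyclic support, a longest path would start at a leaf, where the degree is 1 and hence
odd. -/
theorem IsCycleVector.not_isAcyclic [Fintype V] {c : G.edgeSet → ZMod 2} (hc : IsCycleVector G c)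
    {e₀ : G.edgeSet} (he₀ : c e₀ ≠ 0) :
    ¬ (SimpleGraph.fromEdgeSet {e | ∃ h : e ∈ G.edgeSet, c ⟨e, h⟩ ≠ 0}).IsAcyclic := by
  set H := SimpleGraph.fromEdgeSet {e | ∃ h : e ∈ G.edgeSet, c ⟨e, h⟩ ≠ 0} with hH
  have hadj : ∀ u v, H.Adj u v ↔ ∃ h : G.Adj u v, c ⟨s(u, v), h⟩ ≠ 0 := by
    intro u v
    rw [hH, SimpleGraph.fromEdgeSet_adj]
    exact ⟨fun h => h.1, fun h => ⟨h, h.1.ne⟩⟩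
  intro hac
  obtain ⟨⟨e₀, he⟩, rfl⟩ : ∃ e, e₀ = e := ⟨_, rfl⟩
  induction e₀ using Sym2.ind with
  | _ x y =>
  have hxy : H.Adj x y := (hadj x y).2 ⟨he, he₀⟩
  have : Nonempty V := ⟨x⟩
  obtain ⟨u, v, p, hp, hmax⟩ := SimpleGraph.Walk.exists_isPath_forall_isPath_length_le_length H
  have hlen : 0 < p.length :=
    hmax x y hxy.toWalk (SimpleGraph.Walk.IsPath.of_adj hxy)
  have hnil : ¬ p.Nil := by
    rw [← SimpleGraph.Walk.length_eq_zero_iff]; omega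
  have hsnd : ∀ w, H.Adj u w → w = p.snd := by
    intro w hw
    refine hac.eq_snd_of_adj_start hp hw ?_
    by_contra hmem
    have := hmax w v (SimpleGraph.Walk.cons hw.symm p) (hp.cons hmem)
    rw [SimpleGraph.Walk.length_cons] at this
    omega
  obtain ⟨h1, h2⟩ := (hadj _ _).1 (p.adj_snd hnil)
  have h3 := hc u
  rw [Finset.sum_eq_single ⟨s(u, p.snd), h1⟩] at h3
  · simp only [Sym2.mem_iff, true_or, if_true] at h3
    exact h2 h3
  · rintro ⟨e, he⟩ - hne
    by_contra h
    by_cases hu : u ∈ e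
    · simp only [hu, if_true] at h
      obtain ⟨w, rfl⟩ := hu
      exact hne (by simp only [← hsnd w ((hadj u w).2 ⟨he, h⟩)])
    · simp [hu] at h
  · simp

/-- A nonzero cycle vector has at least girth many edges. -/
theorem IsCycleVector.le_card [Fintype V] {c : G.edgeSet → ZMod 2} (hc : IsCycleVector G c)
    (hc0 : c ≠ 0) {k : ℕ} (hk : k ≤ G.egirth) :
    k ≤ (Finset.univ.filter fun e => c e ≠ 0).card := by
  obtain ⟨e₀, he₀⟩ := Function.ne_iff.1 hc0
  have hac := hc.not_isAcyclic he₀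
  set H := SimpleGraph.fromEdgeSet {e | ∃ h : e ∈ G.edgeSet, c ⟨e, h⟩ ≠ 0} with hH
  have hmem : ∀ e ∈ H.edgeSet, ∃ h : e ∈ G.edgeSet, c ⟨e, h⟩ ≠ 0 := by
    intro e he
    rw [hH, SimpleGraph.edgeSet_fromEdgeSet] at he
    exact he.1
  have hle : H ≤ G := SimpleGraph.edgeSet_subset_edgeSet.1 fun e he => (hmem e he).1
  simp only [SimpleGraph.IsAcyclic] at hac
  push Not at hac
  obtain ⟨a, w, hw⟩ := hac
  have h1 := SimpleGraph.le_egirth.1 hk a (w.mapLe hle) (hw.mapLe hle)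
  have h2 : k ≤ w.length := by simpa using h1
  calc k ≤ w.edges.toFinset.card := by
        rw [List.toFinset_card_of_nodup hw.edges_nodup, SimpleGraph.Walk.length_edges]
        exact h2
    _ ≤ ((Finset.univ.filter fun e => c e ≠ 0).map ⟨Subtype.val, Subtype.val_injective⟩).card := by
        refine Finset.card_le_card fun e he => ?_
        obtain ⟨h, h'⟩ := hmem e (w.edges_subset_edgeSet (by simpa using he))
        exact Finset.mem_map.2 ⟨⟨e, h⟩, by simpa using h', rfl⟩
    _ = _ := Finset.card_map _

variable (G) in
/-- The boundary map on the edge space. -/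
noncomputable def boundary [Fintype G.edgeSet] : (G.edgeSet → ZMod 2) →ₗ[ZMod 2] (V → ZMod 2) where
  toFun c w := ∑ e : G.edgeSet, if w ∈ e.1 then c e else 0
  map_add' c d := by
    ext w
    simp only [Pi.add_apply, ← Finset.sum_add_distrib]
    exact Finset.sum_congr rfl fun e _ => by split_ifs <;> simp
  map_smul' t c := by
    ext w
    simp only [Pi.smul_apply, smul_eq_mul, Finset.mul_sum, mul_ite, mul_zero, RingHom.id_apply]

theorem mem_ker_boundary [Fintype G.edgeSet] {c : G.edgeSet → ZMod 2} :
    c ∈ LinearMap.ker (boundary G) ↔ IsCycleVector G c := by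
  rw [LinearMap.mem_ker, funext_iff]; rfl

/-- Rank-nullity: every edge has two ends, so the image of the boundary map lies in the proper
subspace of functions with sum zero. Connectedness plays no role. -/
theorem card_edgeSet_lt_finrank_add [Fintype V] [Nonempty V] :
    Fintype.card G.edgeSet <
      Module.finrank (ZMod 2) (LinearMap.ker (boundary G)) + Fintype.card V := by
  have h1 := LinearMap.finrank_range_add_finrank_ker (boundary G)
  rw [Module.finrank_fintype_fun_eq_card] at h1
  have hsum : ∀ c, ∑ w, boundary G c w = 0 := by
    intro c
    change ∑ w, ∑ e : G.edgeSet, (if w ∈ e.1 then c e else 0) = 0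
    rw [Finset.sum_comm]
    refine Finset.sum_eq_zero fun e _ => ?_
    obtain ⟨e, he⟩ := e
    induction e using Sym2.ind with
    | _ x y =>
    have hxy : x ≠ y := SimpleGraph.Adj.ne he
    rw [← Finset.sum_filter, show (Finset.univ.filter fun w => w ∈ s(x, y)) = {x, y} by ext; simp,
      Finset.sum_pair hxy]
    exact CharTwo.add_self_eq_zero _
  have hlt : Module.finrank (ZMod 2) (LinearMap.range (boundary G)) < Fintype.card V := by
    rw [← Module.finrank_fintype_fun_eq_card (ZMod 2) (η := V)]
    refine Submodule.finrank_lt fun htop => ?_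
    obtain ⟨w⟩ := ‹Nonempty V›
    obtain ⟨c, hc⟩ := LinearMap.range_eq_top.1 htop (Pi.single w 1)
    have := hsum c
    rw [hc, Finset.sum_pi_single'] at this
    simp at this
  omega

/-- The consequence of Euler's formula for planar graphs of girth at least `k`. -/
theorem IsPlanar.mul_card_edgeSet_le [Fintype V] [Nonempty V] (hG : IsPlanar G) {k : ℕ}
    (hk : k ≤ G.egirth) :
    k * (Fintype.card G.edgeSet + 1) ≤ 2 * Fintype.card G.edgeSet + k * Fintype.card V := by
  let W := LinearMap.ker (boundary G)
  let β := Module.finBasis (ZMod 2) W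
  obtain ⟨z, hz1, hz2, hz3⟩ := hG.exists_faces (fun i => (β i : G.edgeSet → ZMod 2))
    fun i => mem_ker_boundary.1 (β i).2
  let K := Finset.univ.filter fun κ => z κ ≠ 0
  have hspan : W ≤ Submodule.span (ZMod 2) (K.image z : Set (G.edgeSet → ZMod 2)) := by
    intro c hc
    have hbasis : ∀ i, (β i : G.edgeSet → ZMod 2) ∈
        Submodule.span (ZMod 2) (K.image z : Set (G.edgeSet → ZMod 2)) := by
      intro i
      have : (β i : G.edgeSet → ZMod 2) = ∑ κ, κ i • z κ := by
        ext e
        rw [hz3 i e]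
        simp
      rw [this]
      refine Submodule.sum_mem _ fun κ _ => Submodule.smul_mem _ _ ?_
      by_cases h : z κ = 0
      · rw [h]; exact Submodule.zero_mem _
      · exact Submodule.subset_span (by
          simp only [Finset.coe_image]
          exact ⟨κ, by simp [K, h], rfl⟩)
    have := β.sum_repr ⟨c, hc⟩
    have hcsum : c = ∑ i, β.repr ⟨c, hc⟩ i • (β i : G.edgeSet → ZMod 2) := by
      have h := congrArg (Submodule.subtype W) this
      rw [map_sum] at h
      exact h.symm
    rw [hcsum]
    exact Submodule.sum_mem _ fun i _ => Submodule.smul_mem _ _ (hbasis i)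
  have hdim : Module.finrank (ZMod 2) W ≤ K.card :=
    (Submodule.finrank_mono hspan).trans
      ((finrank_span_finset_le_card _).trans Finset.card_image_le)
  -- Double counting of incidences between edges and nonzero face boundaries.
  have hcount : K.card * k ≤ 2 * Fintype.card G.edgeSet := by
    calc K.card * k = ∑ κ ∈ K, k := by simp
      _ ≤ ∑ κ ∈ K, (Finset.univ.filter fun e => z κ e ≠ 0).card :=
        Finset.sum_le_sum fun κ hκ => (hz1 κ).le_card (by simpa [K] using hκ) hk
      _ ≤ ∑ κ, (Finset.univ.filter fun e => z κ e ≠ 0).card :=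
        Finset.sum_le_sum_of_subset (Finset.subset_univ _)
      _ = ∑ e, (Finset.univ.filter fun κ => z κ e ≠ 0).card := by
        simp only [Finset.card_filter]
        exact Finset.sum_comm
      _ ≤ ∑ e : G.edgeSet, 2 := Finset.sum_le_sum fun e _ => hz2 e
      _ = 2 * Fintype.card G.edgeSet := by simp [mul_comm]
  have hlt : Fintype.card G.edgeSet < Module.finrank (ZMod 2) W + Fintype.card V :=
    card_edgeSet_lt_finrank_add
  calc k * (Fintype.card G.edgeSet + 1) ≤ k * (K.card + Fintype.card V) :=
        Nat.mul_le_mul_left k (by omega)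
    _ ≤ _ := by rw [mul_add, mul_comm k K.card]; omega

end Euler

/-! ### Conclusion -/

theorem exists_forall_adj_iff {V : Type*} [Fintype V] {G : SimpleGraph V} [DecidableRel G.Adj]
    {u v : V} (h : G.degree u = 2) (huv : G.Adj u v) :
    ∃ a, a ≠ v ∧ ∀ t, G.Adj u t ↔ t = v ∨ t = a := by
  classical
  obtain ⟨x, y, hxy, he⟩ := Finset.card_eq_two.1 h
  have hmem : ∀ t, G.Adj u t ↔ t = x ∨ t = y := fun t => by
    rw [← G.mem_neighborFinset, he]; simp
  rcases (hmem v).1 huv with rfl | rfl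
  · exact ⟨y, hxy.symm, hmem⟩
  · exact ⟨x, hxy, fun t => (hmem t).trans or_comm⟩

end IndepBondage

theorem mainTheorem3 {V : Type*} [Fintype V] (G : SimpleGraph V) [DecidableRel G.Adj]
    (hplanar : IndepBondage.IsPlanar G) (hdeg : 2 ≤ G.minDegree) (hgirth : 10 ≤ G.egirth) :
    IndepBondage.indepBondageNumber G ≤ 3 := by
  classical
  by_cases h22 : ∃ u v, G.Adj u v ∧ G.degree u = 2 ∧ G.degree v = 2
  · obtain ⟨u, v, huv, hu, hv⟩ := h22
    obtain ⟨a, -, ha⟩ := IndepBondage.exists_forall_adj_iff hu huv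
    obtain ⟨b, -, hb⟩ := IndepBondage.exists_forall_adj_iff hv huv.symm
    exact IndepBondage.indepBondageNumber_le_three_of_adj ha hb
  have h22' : ∀ u v, G.Adj u v → G.degree u = 2 → G.degree v ≠ 2 :=
    fun u v huv hu hv => h22 ⟨u, v, huv, hu, hv⟩
  by_cases h3 : ∃ w, G.degree w = 3 ∧ ∀ v, G.Adj w v → G.degree v = 2
  · obtain ⟨w, hw, hall⟩ := h3
    obtain ⟨x, y, z, hxy, hxz, hyz, he⟩ := Finset.card_eq_three.1 hw
    have hmem : ∀ t, G.Adj w t ↔ t = x ∨ t = y ∨ t = z := fun t => by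
      rw [← G.mem_neighborFinset, he]; simp
    have hwx : G.Adj w x := (hmem x).2 (by simp)
    have hwy : G.Adj w y := (hmem y).2 (by simp)
    have hwz : G.Adj w z := (hmem z).2 (by simp)
    obtain ⟨x', hx', hx⟩ := IndepBondage.exists_forall_adj_iff (hall x hwx) hwx.symm
    obtain ⟨y', hy', hy⟩ := IndepBondage.exists_forall_adj_iff (hall y hwy) hwy.symm
    obtain ⟨z', hz', hz⟩ := IndepBondage.exists_forall_adj_iff (hall z hwz) hwz.symm
    exact IndepBondage.indepBondageNumber_le_three_of_claw hxy hxz hyz hmem hx hy hz hx' hy' hz'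
      (fun h => h22' _ _ h (hall x hwx) (hall y hwy))
      (fun h => h22' _ _ h (hall x hwx) (hall z hwz))
      (fun h => h22' _ _ h (hall y hwy) (hall z hwz))
  push Not at h3
  exfalso
  -- On an empty vertex type `minDegree` is 0 by convention, against `hdeg`.
  have : Nonempty V := by
    by_contra hV
    rw [not_nonempty_iff] at hV
    simp at hdeg
  have h1 := IndepBondage.ten_mul_card_le_eight_mul_card_edgeFinset G
    (fun v => hdeg.trans (G.minDegree_le_degree v)) h22' h3
  have h2 := hplanar.mul_card_edgeSet_le (k := 10) (by exact_mod_cast hgirth)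
  have h3 : G.edgeFinset.card = Fintype.card G.edgeSet := by
    rw [SimpleGraph.edgeFinset_card]
  -- The two counts of edges use different `Fintype` instances, which must be identified before the
  -- inequalities are compared.
  have h4 : ∀ i j : Fintype G.edgeSet, @Fintype.card _ i = @Fintype.card _ j := fun i j => by
    congr!
  rw [h3, h4 _ inferInstance] at h1
  rw [h4 _ inferInstance] at h2
  omega
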